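/- Let $\Bbbk$ be a field of characteristic $0$, let $n\ge 0$, let $S=\Bbbk[x_1,\dots,x_n]$ with its standard grading ($\deg x_j=1$), and let $\Delta$ be a simplicial complex on the vertex set $\{1,\dots,n\}$ (the empty set counts as a face; not every $\{j\}$ has to be a face). For $i\ge 0$ let $\mathbf K_i^\Delta$ be the free $S$-module with basis the exterior monomials $v_\sigma=v_{j_1}\wedge\cdots\wedge v_{j_i}$, where $\sigma=\{j_1<\dots<j_i\}$ runs over the faces of $\Delta$ with $i$ elements, graded by $\deg v_\sigma=i$. With the Koszul differential $$\partial v_\sigma=\sum_{j\in\sigma}(-1)^{\#\{l\in\sigma\,:\,l<j\}}\,x_j\,v_{\sigma\setminus\{j\}}$$ these modules form a complex $\mathbf K^\Delta_\bullet$ of graded $S$-modules, a subcomplex of the Koszul complex of $x_1,\dots,x_n$. Let $W_i(\Delta)=H_i(\mathbf K^\Delta_\bullet)$ be the $i$-th Koszul module of $\Delta$, a graded $S$-module. For a finitely generated graded $S$-module $M$ with minimal graded free resolution $\mathbf F_\bullet$, the Castelnuovo–Mumford regularity of $M$ is the supremum of $j-h$ over all $h\ge 0$ and all degrees $j$ of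 elements of a homogeneous basis of $\mathbf F_h$. The zero module has regularity and projective dimension $-\infty$. Then, for every $i>0$, the module $W_i(\Delta)$ has Castelnuovo–Mumford regularity at most $n$ and projective dimension over $S$ at most $n-i-1$. (In particular, $W_i(\Delta)=0$ if $i\ge n$.) -/

import Mathlib

noncomputable section

namespace KoszulModule

universe u v

/-! ### The Koszul modules of a simplicial complex -/

section Complex

variable (k : Type u) [Field k] (n : ℕ)

/-- The Koszul complex of `x_1, …, x_n` over `S = k[x_1, …, x_n]` in all homological degrees at
once: the free `S`-module on the exterior monomials `v_σ`, where `v_σ = v_{j_1} ∧ ⋯ ∧ v_{j_i}`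
for `σ = {j_1 < ⋯ < j_i}`. The coefficient of `v_σ` in `z` is `z σ`. -/
abbrev Koszul : Type u := Finset (Fin n) → MvPolynomial (Fin n) k

/-- The boundary of a basis element:
`∂ v_σ = ∑_{j ∈ σ} (-1)^{#{l ∈ σ : l < j}} x_j v_{σ ∖ {j}}`. -/
def boundaryBasis (σ : Finset (Fin n)) : Koszul k n :=
  ∑ j ∈ σ, Pi.single (σ.erase j)
    ((-1 : MvPolynomial (Fin n) k) ^ (σ.filter (· < j)).card * MvPolynomial.X j)

/-- The Koszul differential: the `S`-linear map with `v_σ ↦ ∂ v_σ`. -/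
def boundary : Koszul k n →ₗ[MvPolynomial (Fin n) k] Koszul k n :=
  Fintype.linearCombination (MvPolynomial (Fin n) k) (boundaryBasis k n)

variable {n}

/-- The `i`-th module of the subcomplex of the Koszul complex determined by `Δ`: the free module
on the `v_σ` with `σ` a face of `Δ` with `i` vertices. The empty set, which Mathlib does not list
among the faces, counts as a face. -/
def chains (Δ : PreAbstractSimplicialComplex (Fin n)) (i : ℕ) :
    Submodule (MvPolynomial (Fin n) k) (Koszul k n) where
  carrier := {z | ∀ σ, z σ ≠ 0 → σ.card = i ∧ (σ = ∅ ∨ σ ∈ Δ)}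
  zero_mem' := by simp
  add_mem' := by
    intro a b ha hb σ h
    by_cases h0 : a σ = 0
    · exact hb σ fun h1 => h (by simp [h0, h1])
    · exact ha σ h0
  smul_mem' := by
    intro c a ha σ h
    exact ha σ fun h0 => h (by simp [h0])

/-- The `i`-cycles of the subcomplex. -/
def cycles (Δ : PreAbstractSimplicialComplex (Fin n)) (i : ℕ) :
    Submodule (MvPolynomial (Fin n) k) (Koszul k n) :=
  chains k Δ i ⊓ LinearMap.ker (boundary k n)

/-- The `i`-boundaries of the subcomplex. -/
def boundaries (Δ : PreAbstractSimplicialComplex (Fin n)) (i : ℕ) :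
    Submodule (MvPolynomial (Fin n) k) (Koszul k n) :=
  (chains k Δ (i + 1)).map (boundary k n)

/-- The `i`-th Koszul module `W_i(Δ)`: the `i`-th homology of the subcomplex
(see `boundaries_le_cycles`). -/
abbrev W (Δ : PreAbstractSimplicialComplex (Fin n)) (i : ℕ) : Type u :=
  cycles k Δ i ⧸ (boundaries k Δ i).submoduleOf (cycles k Δ i)

variable (n) in
/-- The elements of the Koszul complex that are homogeneous of degree `d`, where the variables
`x_j` and the exterior generators `v_j` all have degree `1`. -/
def homogeneous (d : ℤ) : AddSubgroup (Koszul k n) where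
  carrier := {z | ∀ σ, ∀ m ∈ (z σ).support, (m.degree : ℤ) + σ.card = d}
  zero_mem' := by simp
  add_mem' := by
    classical
    intro a b ha hb σ m hm
    rcases Finset.mem_union.1 (MvPolynomial.support_add hm) with h | h
    exacts [ha σ m h, hb σ m h]
  neg_mem' := by
    intro a ha σ m hm
    exact ha σ m (by simpa using hm)

/-- The degree `d` component of `W_i(Δ)`: the classes of homogeneous cycles of degree `d`. -/
def gradedPiece (Δ : PreAbstractSimplicialComplex (Fin n)) (i : ℕ) (d : ℤ) :
    AddSubgroup (W k Δ i) :=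
  ((homogeneous k n d).comap (cycles k Δ i).subtype.toAddMonoidHom).map
    ((boundaries k Δ i).submoduleOf (cycles k Δ i)).mkQ.toAddMonoidHom

/-! The differential maps `chains (i + 1)` to `chains i` and squares to zero. -/

lemma boundary_single (σ : Finset (Fin n)) (f : MvPolynomial (Fin n) k) :
    boundary k n (Pi.single σ f) = f • boundaryBasis k n σ := by
  simp [boundary, Fintype.linearCombination_apply_single]

lemma boundary_boundaryBasis (σ : Finset (Fin n)) :
    boundary k n (boundaryBasis k n σ) = 0 := by
  classical
  rw [boundaryBasis, map_sum]
  simp only [boundary_single]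
  simp only [boundaryBasis, Finset.smul_sum, ← Pi.single_smul, smul_eq_mul]
  rw [Finset.sum_sigma']
  have key : ∀ j l : Fin n, j ∈ σ → l ∈ σ → j < l →
      (-1 : MvPolynomial (Fin n) k) ^ (σ.filter (· < j)).card * MvPolynomial.X j *
        ((-1) ^ ((σ.erase j).filter (· < l)).card * MvPolynomial.X l) +
      (-1 : MvPolynomial (Fin n) k) ^ (σ.filter (· < l)).card * MvPolynomial.X l *
        ((-1) ^ ((σ.erase l).filter (· < j)).card * MvPolynomial.X j) = 0 := by
    intro j l hj hl hjl
    have h1 : (σ.erase l).filter (· < j) = σ.filter (· < j) := by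
      ext x; simp only [Finset.mem_filter, Finset.mem_erase]; grind
    have h2 : σ.filter (· < l) = insert j ((σ.erase j).filter (· < l)) := by
      ext x; simp only [Finset.mem_filter, Finset.mem_erase, Finset.mem_insert]; grind
    rw [h1, h2, Finset.card_insert_of_notMem (by simp)]
    ring
  refine Finset.sum_involution (fun a _ => ⟨a.2, a.1⟩) ?_ ?_ ?_ ?_
  · rintro ⟨j, l⟩ h
    simp only [Finset.mem_sigma, Finset.mem_erase] at h
    rw [Finset.erase_right_comm, ← Pi.single_add]
    rcases lt_or_gt_of_ne h.2.1 with hlt | hlt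
    · rw [add_comm, key l j h.2.2 h.1 hlt, Pi.single_zero]
    · rw [key j l h.1 h.2.2 hlt, Pi.single_zero]
  · rintro ⟨j, l⟩ h _ heq
    simp only [Finset.mem_sigma, Finset.mem_erase] at h
    simp only [Sigma.mk.injEq, heq_eq_eq] at heq
    exact h.2.1 heq.1
  · rintro ⟨j, l⟩ h
    simp only [Finset.mem_sigma, Finset.mem_erase] at h ⊢
    exact ⟨h.2.2, h.2.1.symm, h.1⟩
  · rintro ⟨j, l⟩ h
    rfl

lemma boundary_boundary (z : Koszul k n) : boundary k n (boundary k n z) = 0 := by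
  have hz : boundary k n z = ∑ σ, z σ • boundaryBasis k n σ := by
    rw [boundary, Fintype.linearCombination_apply]
  rw [hz, map_sum]
  exact Finset.sum_eq_zero fun σ _ => by
    rw [map_smul, boundary_boundaryBasis, smul_zero]

lemma single_mem_chains (Δ : PreAbstractSimplicialComplex (Fin n)) {i : ℕ} {σ : Finset (Fin n)}
    (hc : σ.card = i) (hσ : σ = ∅ ∨ σ ∈ Δ) (f : MvPolynomial (Fin n) k) :
    (Pi.single σ f : Koszul k n) ∈ chains k Δ i := by
  intro τ hτ
  rcases eq_or_ne τ σ with rfl | h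
  · exact ⟨hc, hσ⟩
  · exact absurd (by simp [h]) hτ

lemma boundary_mem_chains (Δ : PreAbstractSimplicialComplex (Fin n)) (i : ℕ) {z : Koszul k n}
    (hz : z ∈ chains k Δ (i + 1)) : boundary k n z ∈ chains k Δ i := by
  rw [boundary, Fintype.linearCombination_apply]
  refine Submodule.sum_mem _ fun σ _ => ?_
  by_cases h0 : z σ = 0
  · simp [h0]
  obtain ⟨hc, hf⟩ := hz σ h0
  refine Submodule.smul_mem _ _ (Submodule.sum_mem _ fun j hj => single_mem_chains k Δ ?_ ?_ _)
  · rw [Finset.card_erase_of_mem hj, hc]; rfl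
  rcases hf with rfl | hf
  · simp at hj
  · rcases (σ.erase j).eq_empty_or_nonempty with h | h
    · exact Or.inl h
    · exact Or.inr ((Δ.isRelLowerSet_faces hf).2 (Finset.erase_subset j σ) h)

lemma boundaries_le_cycles (Δ : PreAbstractSimplicialComplex (Fin n)) (i : ℕ) :
    boundaries k Δ i ≤ cycles k Δ i := by
  rintro _ ⟨z, hz, rfl⟩
  exact ⟨boundary_mem_chains k Δ i hz, boundary_boundary k z⟩

end Complex

/-! ### Castelnuovo–Mumford regularity -/

section Regularity

variable {k : Type u} [Field k] {n : ℕ} {M : Type v} [AddCommGroup M]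
  [Module (MvPolynomial (Fin n) k) M]

/-- A minimal graded free resolution `⋯ → F_1 → F_0 → M → 0` over `S = k[x_1, …, x_n]` of a
module `M` whose degree `j` component is `𝓜 j`. Here `F_h` is the free module with basis
`e_b = Pi.single b 1`, where `b : Fin (rank h)`, graded by giving `e_b` the degree `deg h b`. -/
structure MinimalGradedFreeResolution (𝓜 : ℤ → AddSubgroup M) where
  rank : ℕ → ℕ
  deg : ∀ h, Fin (rank h) → ℤ
  d : ∀ h, (Fin (rank (h + 1)) → MvPolynomial (Fin n) k) →ₗ[MvPolynomial (Fin n) k]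
    (Fin (rank h) → MvPolynomial (Fin n) k)
  ε : (Fin (rank 0) → MvPolynomial (Fin n) k) →ₗ[MvPolynomial (Fin n) k] M
  /-- The augmentation and the differentials preserve degrees. -/
  ε_homogeneous : ∀ b, ε (Pi.single b 1) ∈ 𝓜 (deg 0 b)
  d_homogeneous : ∀ h b c, ∀ m ∈ (d h (Pi.single b 1) c).support,
    (m.degree : ℤ) + deg h c = deg (h + 1) b
  ε_surjective : Function.Surjective ε
  exact_zero : Function.Exact (d 0) ε
  exact_succ : ∀ h, Function.Exact (d (h + 1)) (d h)
  /-- The entries of the differentials lie in the ideal `(x_1, …, x_n)`. -/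
  minimal : ∀ h b c, MvPolynomial.constantCoeff (d h (Pi.single b 1) c) = 0

/-- The Castelnuovo–Mumford regularity of a graded `S`-module: the supremum of `j - h` over all
degrees `j` of basis elements of `F_h`, for `F` the minimal graded free resolution. Since `F` is
unique up to isomorphism, the infimum over `F` is over equal values (it is `⊤` when there is no
minimal resolution by free modules of finite rank). The zero module has regularity `⊥ = -∞`. -/
def regularity (𝓜 : ℤ → AddSubgroup M) : WithBot (WithTop ℤ) :=
  ⨅ F : MinimalGradedFreeResolution (k := k) (n := n) 𝓜,
    ⨆ (h : ℕ) (b : Fin (F.rank h)), (((F.deg h b - h : ℤ) : WithTop ℤ) : WithBot (WithTop ℤ))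

end Regularity

end KoszulModule

end

noncomputable section

namespace KoszulModule

universe u v w

open MvPolynomial CategoryTheory

/-! ### Multigraded free modules -/

section Free

/-! Refine the grading to multidegrees in `ℕ^n`, with `v_σ` in the squarefree multidegree with
support `σ`. The Koszul modules are then squarefree modules: multiplication by `x_j` from
multidegree `a` to `a + e_j` is bijective whenever `a_j > 0`. It is so on the free modules of chains
and commutes with `∂`, so it is so on homology (`isSquarefree_koszulPart`).

By graded Nakayama, a squarefree module has a minimal free cover with generators in squarefree
multidegrees, of total degree at most `n` (`IsSquarefree.exists_minimal_cover`), and the kernel of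
such a cover is again squarefree (`IsSquarefree.ker`). Iterating, all basis degrees in the minimal
resolution are at most `n`, so the regularity is at most `n`.

For the projective dimension, follow the smallest support size `d` of a nonzero squarefree
multidegree. Minimality makes it increase by at least one on passing to the kernel, so the
resolution stops once `d` exceeds `n` (`IsSquarefree.exists_resolution`). For `W_i` with `i > 0` one
may start at `d = i + 1`: a cycle in a squarefree multidegree of support size at most `i` is a
multiple of one `v_B`, and `∂ v_B ≠ 0` (`koszulPart_sqfree_eq_bot`). -/

/-- The squarefree exponent vector with support `B`. -/
def sqfree {n : ℕ} (B : Finset (Fin n)) : Fin n →₀ ℕ := Finsupp.indicator B fun _ _ => 1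

variable {n : ℕ}

lemma sqfree_apply (B : Finset (Fin n)) (j : Fin n) : sqfree B j = if j ∈ B then 1 else 0 := by
  classical
  simp [sqfree, Finsupp.indicator_apply]

lemma degree_sqfree (B : Finset (Fin n)) : (sqfree B).degree = B.card := by
  simp [Finsupp.degree_eq_sum, sqfree_apply]

lemma subset_of_add_sqfree_eq {m : Fin n →₀ ℕ} {B C : Finset (Fin n)}
    (h : m + sqfree B = sqfree C) : B ⊆ C := by
  intro j hj
  have := DFunLike.congr_fun h j
  rw [Finsupp.add_apply, sqfree_apply, sqfree_apply] at this
  grind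

lemma sqfree_erase_add {B : Finset (Fin n)} {j : Fin n} (hj : j ∈ B) :
    sqfree (B.erase j) + Finsupp.single j 1 = sqfree B := by
  ext l
  rw [Finsupp.add_apply, sqfree_apply, sqfree_apply, Finsupp.single_apply]
  grind

/-- An exponent vector is squarefree, or of the form `b + e_j` with `b_j > 0`. -/
lemma exists_eq_sqfree_or (a : Fin n →₀ ℕ) :
    (∃ B, a = sqfree B) ∨ ∃ b j, 0 < b j ∧ a = b + Finsupp.single j 1 := by
  classical
  by_cases h : ∃ j, 2 ≤ a j
  · obtain ⟨j, hj⟩ := h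
    refine Or.inr ⟨a - Finsupp.single j 1, j, by simp; omega, ?_⟩
    ext l
    rcases eq_or_ne l j with rfl | h
    · simp; omega
    · simp [h.symm]
  · push Not at h
    refine Or.inl ⟨Finset.univ.filter fun j => a j ≠ 0, ?_⟩
    ext l
    have := h l
    rw [sqfree_apply]
    simp only [Finset.mem_filter, Finset.mem_univ, true_and]
    split_ifs <;> omega

variable (k : Type u) [Field k] {ι : Type w} (A : ι → Finset (Fin n))

/-- The multidegree `a` part of the free module whose `b`-th basis vector has multidegree
`sqfree (A b)`. -/
def freePart (a : Fin n →₀ ℕ) : Submodule k (ι → MvPolynomial (Fin n) k) where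
  carrier := {z | ∀ b, ∀ m ∈ (z b).support, m + sqfree (A b) = a}
  zero_mem' := by simp
  add_mem' := by
    classical
    intro y z hy hz b m hm
    rcases Finset.mem_union.1 (support_add hm) with h | h
    exacts [hy b m h, hz b m h]
  smul_mem' := by
    intro c z hz b m hm
    exact hz b m (support_smul hm)

variable {k A}

lemma mem_freePart {a : Fin n →₀ ℕ} {z : ι → MvPolynomial (Fin n) k} :
    z ∈ freePart k A a ↔ ∀ b m, coeff m (z b) ≠ 0 → m + sqfree (A b) = a := by
  simp [freePart]

variable (k A) in
/-- The projection of a multigraded free module to its part of multidegree `a`. -/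
def freeProj (a : Fin n →₀ ℕ) :
    (ι → MvPolynomial (Fin n) k) →+ (ι → MvPolynomial (Fin n) k) where
  toFun z b := if sqfree (A b) ≤ a then
    monomial (a - sqfree (A b)) (coeff (a - sqfree (A b)) (z b)) else 0
  map_zero' := by ext; simp
  map_add' y z := by
    ext b m
    simp only [Pi.add_apply]
    split_ifs <;> simp

lemma coeff_freeProj (a : Fin n →₀ ℕ) (z : ι → MvPolynomial (Fin n) k) (b : ι)
    (m : Fin n →₀ ℕ) :
    coeff m (freeProj k A a z b) = if m + sqfree (A b) = a then coeff m (z b) else 0 := by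
  classical
  simp only [freeProj, AddMonoidHom.coe_mk, ZeroHom.coe_mk]
  split_ifs with h1 h2 h2
  · subst h2; simp
  · rw [coeff_monomial, if_neg]
    rintro rfl
    exact h2 (tsub_add_cancel_of_le h1)
  · exact absurd (h2 ▸ le_add_self) h1
  · simp

lemma freeProj_mem (a : Fin n →₀ ℕ) (z : ι → MvPolynomial (Fin n) k) :
    freeProj k A a z ∈ freePart k A a := by
  rw [mem_freePart]
  intro b m hm
  rw [coeff_freeProj] at hm
  by_contra h
  simp [h] at hm

lemma freeProj_of_mem {a : Fin n →₀ ℕ} {z : ι → MvPolynomial (Fin n) k}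
    (hz : z ∈ freePart k A a) (a' : Fin n →₀ ℕ) :
    freeProj k A a' z = if a = a' then z else 0 := by
  ext b m
  rw [mem_freePart] at hz
  rw [coeff_freeProj]
  have := hz b m
  by_cases h0 : coeff m (z b) = 0
  · split_ifs <;> simp [h0]
  · rw [this h0]
    split_ifs <;> simp

lemma freeProj_sum {s : Finset (Fin n →₀ ℕ)} {z : (Fin n →₀ ℕ) → ι → MvPolynomial (Fin n) k}
    (hz : ∀ a ∈ s, z a ∈ freePart k A a) {a : Fin n →₀ ℕ} (ha : a ∈ s) :
    freeProj k A a (∑ a' ∈ s, z a') = z a := by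
  rw [map_sum, Finset.sum_eq_single a]
  · rw [freeProj_of_mem (hz a ha), if_pos rfl]
  · intro b hb hba
    rw [freeProj_of_mem (hz b hb), if_neg hba]
  · exact fun h => absurd ha h

lemma freeProj_ne_zero {a : Fin n →₀ ℕ} {z : ι → MvPolynomial (Fin n) k} {b : ι}
    (h : freeProj k A a z b ≠ 0) : z b ≠ 0 := by
  rintro h0
  exact h (by simp [freeProj, h0])

lemma exists_sum_freeProj [Fintype ι] (z : ι → MvPolynomial (Fin n) k) :
    ∃ s : Finset (Fin n →₀ ℕ), z = ∑ a ∈ s, freeProj k A a z := by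
  classical
  refine ⟨Finset.univ.biUnion fun b => (z b).support.image fun m => m + sqfree (A b), ?_⟩
  ext b m
  rw [Finset.sum_apply, coeff_sum]
  simp only [coeff_freeProj]
  rw [Finset.sum_ite_eq]
  split_ifs with h
  · rfl
  · by_contra h0
    exact h (Finset.mem_biUnion.2 ⟨b, Finset.mem_univ _,
      Finset.mem_image_of_mem _ (mem_support_iff.2 h0)⟩)

lemma X_smul_mem_freePart {a : Fin n →₀ ℕ} {z : ι → MvPolynomial (Fin n) k}
    (hz : z ∈ freePart k A a) (j : Fin n) :
    (X j : MvPolynomial (Fin n) k) • z ∈ freePart k A (a + Finsupp.single j 1) := by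
  classical
  rw [mem_freePart] at hz ⊢
  intro b m hm
  rw [Pi.smul_apply, smul_eq_mul, coeff_X_mul'] at hm
  split_ifs at hm with h
  · rw [← hz b _ hm, add_right_comm, tsub_add_cancel_of_le]
    rw [Finsupp.single_le_iff]
    exact Nat.one_le_iff_ne_zero.2 (Finsupp.mem_support_iff.1 h)
  · exact absurd rfl hm

/-- A generator has exponent at most 1 in `x_j`, while `a + e_j` has exponent at least 2, so every
coefficient is divisible by `x_j`. The clause on nonzero entries keeps the quotient inside the
chains of a subcomplex. -/
lemma exists_X_smul_eq {a : Fin n →₀ ℕ} {j : Fin n} (ha : 0 < a j)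
    {z : ι → MvPolynomial (Fin n) k} (hz : z ∈ freePart k A (a + Finsupp.single j 1)) :
    ∃ y ∈ freePart k A a, (X j : MvPolynomial (Fin n) k) • y = z ∧ ∀ b, y b ≠ 0 → z b ≠ 0 := by
  classical
  rw [mem_freePart] at hz
  have key : (X j : MvPolynomial (Fin n) k) •
      (fun b => (z b).divMonomial (Finsupp.single j 1)) = z := by
    ext b m
    rw [Pi.smul_apply, smul_eq_mul, coeff_X_mul', coeff_divMonomial]
    split_ifs with h
    · rw [add_tsub_cancel_of_le]
      rw [Finsupp.single_le_iff]
      exact Nat.one_le_iff_ne_zero.2 (Finsupp.mem_support_iff.1 h)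
    · by_contra h0
      have := DFunLike.congr_fun (hz b m (Ne.symm h0)) j
      rw [Finsupp.notMem_support_iff] at h
      simp only [Finsupp.add_apply, h, sqfree_apply, Finsupp.single_eq_same] at this
      grind
  refine ⟨_, mem_freePart.2 ?_, key, ?_⟩
  · intro b m hm
    rw [coeff_divMonomial] at hm
    have := hz b _ hm
    rw [add_assoc, add_comm] at this
    exact add_right_cancel this
  · rintro b hb h0
    exact hb (by rw [h0, zero_divMonomial])

lemma X_smul_injective (j : Fin n) {y z : ι → MvPolynomial (Fin n) k}
    (h : (X j : MvPolynomial (Fin n) k) • y = (X j : MvPolynomial (Fin n) k) • z) : y = z :=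
  smul_right_injective _ (X_ne_zero j) h

/-- Each basis vector contributes at most one monomial in a given multidegree, so an element is
determined by one scalar per basis vector. -/
instance [Fintype ι] (a : Fin n →₀ ℕ) : Module.Finite k (freePart k A a) := by
  let φ : freePart k A a →ₗ[k] ι → k :=
    { toFun := fun z b => coeff (a - sqfree (A b)) (z.1 b)
      map_add' := fun y z => by ext b; simp
      map_smul' := fun c z => by ext b; simp }
  refine Module.Finite.of_injective φ ((injective_iff_map_eq_zero _).2 ?_)
  rintro ⟨z, hz⟩ h
  rw [mem_freePart] at hz
  ext b m
  by_contra h0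
  have h1 := hz b m h0
  have h2 := congrFun h b
  simp only [φ, LinearMap.coe_mk, AddHom.coe_mk, ← h1, add_tsub_cancel_right] at h2
  exact h0 h2

lemma eq_C_of_mem_freePart_sqfree {b : ι} {z : ι → MvPolynomial (Fin n) k}
    (hz : z ∈ freePart k A (sqfree (A b))) : z b = C (constantCoeff (z b)) := by
  classical
  rw [mem_freePart] at hz
  ext m
  rw [coeff_C, constantCoeff_eq]
  split_ifs with h
  · rw [h]
  · by_contra h0
    have := hz b m h0
    exact h (by simpa using this : m = 0).symm

lemma subset_of_mem_freePart {b : ι} {B : Finset (Fin n)} {z : ι → MvPolynomial (Fin n) k}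
    (hz : z ∈ freePart k A (sqfree B)) (h : z b ≠ 0) : A b ⊆ B := by
  obtain ⟨m, hm⟩ := ne_zero_iff.1 h
  exact subset_of_add_sqfree_eq (mem_freePart.1 hz b m hm)

end Free

/-! ### Squarefree modules -/

section Squarefree

variable {k : Type u} [Field k] {n : ℕ} {M : Type v} [AddCommGroup M]
  [Module (MvPolynomial (Fin n) k) M] [Module k M]

/-- A multigrading of a module over `k[x_1, …, x_n]` by finite-dimensional pieces which makes it
a squarefree module: multiplication by `x_j` is bijective in all multidegrees whose support
contains `j`. -/
structure IsSquarefree (N : (Fin n →₀ ℕ) → Submodule k M) : Prop where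
  finite : ∀ a, Module.Finite k (N a)
  X_smul_mem : ∀ a j, ∀ m ∈ N a, (X j : MvPolynomial (Fin n) k) • m ∈ N (a + Finsupp.single j 1)
  iSup_eq_top : ⨆ a, N a = ⊤
  eq_zero_of_sum_eq_zero : ∀ (s : Finset (Fin n →₀ ℕ)) (f : (Fin n →₀ ℕ) → M),
    (∀ a ∈ s, f a ∈ N a) → ∑ a ∈ s, f a = 0 → ∀ a ∈ s, f a = 0
  eq_zero_of_X_smul_eq_zero : ∀ a j, 0 < a j → ∀ m ∈ N a,
    (X j : MvPolynomial (Fin n) k) • m = 0 → m = 0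
  exists_X_smul_eq : ∀ a j, 0 < a j → ∀ m ∈ N (a + Finsupp.single j 1),
    ∃ m' ∈ N a, (X j : MvPolynomial (Fin n) k) • m' = m

variable [IsScalarTower k (MvPolynomial (Fin n) k) M] {N : (Fin n →₀ ℕ) → Submodule k M}

lemma monomial_smul_mem_of_X_smul_mem (hN : ∀ a j, ∀ m ∈ N a,
    (X j : MvPolynomial (Fin n) k) • m ∈ N (a + Finsupp.single j 1)) (b : Fin n →₀ ℕ) (c : k)
    {a : Fin n →₀ ℕ} {m : M} (hm : m ∈ N a) :
    (monomial b c : MvPolynomial (Fin n) k) • m ∈ N (b + a) := by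
  have key : ∀ {a : Fin n →₀ ℕ} {m : M}, m ∈ N a →
      (monomial b 1 : MvPolynomial (Fin n) k) • m ∈ N (b + a) := by
    clear hm
    induction b using Finsupp.induction_linear with
    | zero => intro a m hm; simpa using hm
    | add f g hf hg =>
      intro a m hm
      rw [← one_mul (1 : k), ← monomial_mul, mul_smul, add_assoc]
      exact hf (hg hm)
    | single j r =>
      induction r with
      | zero => intro a m hm; simpa using hm
      | succ r ih =>
        intro a m hm
        rw [Finsupp.single_add, ← one_mul (1 : k), ← monomial_mul, mul_smul, add_assoc,
          add_comm _ a]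
        exact ih (hN _ _ _ hm)
  rw [← mul_one c, ← smul_eq_mul, ← smul_monomial, smul_assoc]
  exact (N _).smul_mem c (key hm)

/-- A linear map from a multigraded free module is multigraded if it is so on the basis vectors. -/
lemma map_mem_of_X_smul_mem (hN : ∀ a j, ∀ m ∈ N a,
    (X j : MvPolynomial (Fin n) k) • m ∈ N (a + Finsupp.single j 1))
    {ι : Type w} [Fintype ι] [DecidableEq ι] {A : ι → Finset (Fin n)}
    (φ : (ι → MvPolynomial (Fin n) k) →ₗ[MvPolynomial (Fin n) k] M)
    (hφ : ∀ b, φ (Pi.single b 1) ∈ N (sqfree (A b))) {a : Fin n →₀ ℕ}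
    {z : ι → MvPolynomial (Fin n) k} (hz : z ∈ freePart k A a) : φ z ∈ N a := by
  rw [LinearMap.pi_apply_eq_sum_univ φ z]
  refine (N a).sum_mem fun b _ => ?_
  have : (fun j => if b = j then (1 : MvPolynomial (Fin n) k) else 0) = Pi.single b 1 := by
    ext j : 1
    simp [Pi.single_apply, eq_comm]
  rw [this, (z b).as_sum, Finset.sum_smul]
  refine (N a).sum_mem fun m hm => ?_
  rw [← hz b m hm]
  exact monomial_smul_mem_of_X_smul_mem hN _ _ (hφ b)

end Squarefree

/-! ### Minimal free covers of squarefree modules -/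

section Cover

variable {k : Type u} [Field k] {n : ℕ} {M : Type v} [AddCommGroup M]
  [Module (MvPolynomial (Fin n) k) M] [Module k M]

/-- The part of multidegree `sqfree B` of `(x_1, …, x_n) M`, for a squarefree module `M`. -/
def decomposable (N : (Fin n →₀ ℕ) → Submodule k M) (B : Finset (Fin n)) : Submodule k M :=
  Submodule.span k {m | ∃ j ∈ B, ∃ m' ∈ N (sqfree (B.erase j)),
    (X j : MvPolynomial (Fin n) k) • m' = m}

variable {N : (Fin n →₀ ℕ) → Submodule k M}

lemma IsSquarefree.decomposable_le (hN : IsSquarefree N) (B : Finset (Fin n)) :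
    decomposable N B ≤ N (sqfree B) := by
  rw [decomposable, Submodule.span_le]
  rintro _ ⟨j, hj, m, hm, rfl⟩
  have := hN.X_smul_mem _ j m hm
  rwa [sqfree_erase_add hj] at this

/-- The `g t` represent a basis of the multidegree `sqfree B` part of `M / (x_1, …, x_n) M`; they
are a basis of the part lying in a complement of the decomposable elements. -/
lemma IsSquarefree.exists_generators_of_degree (hN : IsSquarefree N) (B : Finset (Fin n)) :
    ∃ (s : ℕ) (g : Fin s → M), (∀ t, g t ∈ N (sqfree B)) ∧
      N (sqfree B) ≤ decomposable N B ⊔ Submodule.span k (Set.range g) ∧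
      ∀ c : Fin s → k, ∑ t, c t • g t ∈ decomposable N B → c = 0 := by
  obtain ⟨Q, hQ⟩ := exists_isCompl (decomposable N B)
  have := hN.finite (sqfree B)
  have : Module.Finite k (Q ⊓ N (sqfree B) : Submodule k M) :=
    Submodule.finiteDimensional_of_le inf_le_right
  let e := Module.finBasis k (Q ⊓ N (sqfree B) : Submodule k M)
  refine ⟨_, fun t => (e t : M), fun t => (e t).2.2, ?_, ?_⟩
  · have h : Submodule.span k (Set.range fun t => (e t : M)) = Q ⊓ N (sqfree B) := by
      have := congrArg (Submodule.map (Submodule.subtype _)) e.span_eq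
      rwa [Submodule.map_span, ← Set.range_comp, Submodule.map_top, Submodule.range_subtype] at this
    -- Modular law, available because the decomposable elements lie in `N (sqfree B)`.
    rw [h, ← sup_inf_assoc_of_le _ (hN.decomposable_le B), hQ.sup_eq_top, top_inf_eq]
  · intro c hc
    have h1 : ∑ t, c t • (e t : M) = (∑ t, c t • e t : (Q ⊓ N (sqfree B) : Submodule k M)) := by
      simp
    have h2 : ∑ t, c t • e t = 0 := by
      apply Subtype.ext
      rw [← h1]
      refine (Submodule.disjoint_def.1 hQ.disjoint) _ hc ?_
      rw [h1]
      exact (∑ t, c t • e t).2.1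
    exact funext (Fintype.linearIndependent_iff.1 e.linearIndependent c h2)

/-- There are only finitely many squarefree multidegrees, so the generators chosen in each of them
can be pooled into one finite family. -/
lemma IsSquarefree.exists_generators (hN : IsSquarefree N) :
    ∃ (r : ℕ) (A : Fin r → Finset (Fin n)) (g : Fin r → M), (∀ b, g b ∈ N (sqfree (A b))) ∧
      (∀ B, N (sqfree B) ≤ decomposable N B ⊔ Submodule.span k (Set.range g)) ∧
      ∀ B (c : Fin r → k), (∀ b, A b ≠ B → c b = 0) → ∑ b, c b • g b ∈ decomposable N B →
        c = 0 := by
  choose s g hg hspan hind using hN.exists_generators_of_degree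
  let e := Fintype.equivFin (Σ B : Finset (Fin n), Fin (s B))
  refine ⟨_, fun b => (e.symm b).1, fun b => g _ (e.symm b).2, fun b => hg _ _, ?_, ?_⟩
  · intro B
    refine (hspan B).trans (sup_le_sup_left (Submodule.span_mono ?_) _)
    rintro _ ⟨t, rfl⟩
    exact ⟨e ⟨B, t⟩, congrArg (fun p : Σ B, Fin (s B) => g p.1 p.2) (e.symm_apply_apply _)⟩
  · intro B c hc hmem
    have h0 : ∀ C, C ≠ B → ∀ t, c (e ⟨C, t⟩) = 0 := fun C hC t => hc _ (by simpa using hC)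
    have h1 : ∑ b, c b • g _ (e.symm b).2 = ∑ t, c (e ⟨B, t⟩) • g B t := by
      rw [← e.sum_comp, Fintype.sum_sigma, Finset.sum_eq_single B]
      · refine Finset.sum_congr rfl fun t _ => ?_
        rw [congrArg (fun p : Σ B, Fin (s B) => g p.1 p.2) (e.symm_apply_apply _)]
      · intro C _ hC
        exact Finset.sum_eq_zero fun t _ => by rw [h0 C hC, zero_smul]
      · simp
    have h2 := hind B _ (h1 ▸ hmem)
    ext b
    obtain ⟨⟨C, t⟩, rfl⟩ := e.surjective b
    by_cases hC : C = B
    · subst hC; exact congrFun h2 t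
    · exact h0 C hC t

/-- The grading of the kernel of a map from a multigraded free module. -/
def kerPart {ι : Type w} (A : ι → Finset (Fin n))
    (φ : (ι → MvPolynomial (Fin n) k) →ₗ[MvPolynomial (Fin n) k] M) (a : Fin n →₀ ℕ) :
    Submodule k (LinearMap.ker φ) :=
  (freePart k A a).comap ((LinearMap.ker φ).subtype.restrictScalars k)

variable [IsScalarTower k (MvPolynomial (Fin n) k) M]

/-- Since `φ` is multigraded, the images of the components of `z` are the components of `φ z = 0`,
and these vanish separately. -/
lemma IsSquarefree.map_freeProj_eq_zero (hN : IsSquarefree N) {ι : Type w} [Fintype ι]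
    [DecidableEq ι] {A : ι → Finset (Fin n)}
    {φ : (ι → MvPolynomial (Fin n) k) →ₗ[MvPolynomial (Fin n) k] M}
    (hφ : ∀ b, φ (Pi.single b 1) ∈ N (sqfree (A b))) {z : ι → MvPolynomial (Fin n) k}
    (hz : φ z = 0) (a : Fin n →₀ ℕ) : φ (freeProj k A a z) = 0 := by
  obtain ⟨s, hs⟩ := exists_sum_freeProj (A := A) z
  by_cases ha : a ∈ s
  · refine hN.eq_zero_of_sum_eq_zero s (fun a => φ (freeProj k A a z))
      (fun a _ => map_mem_of_X_smul_mem hN.X_smul_mem φ hφ (freeProj_mem a z)) ?_ a ha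
    rw [← map_sum, ← hs, hz]
  · rw [hs, map_sum, Finset.sum_eq_zero, map_zero]
    intro b hb
    rw [freeProj_of_mem (freeProj_mem b z), if_neg (by rintro rfl; exact ha hb)]

/-- The kernel of a multigraded map from a free module to a squarefree module is squarefree. -/
lemma IsSquarefree.ker (hN : IsSquarefree N) {ι : Type w} [Fintype ι] [DecidableEq ι]
    {A : ι → Finset (Fin n)}
    {φ : (ι → MvPolynomial (Fin n) k) →ₗ[MvPolynomial (Fin n) k] M}
    (hφ : ∀ b, φ (Pi.single b 1) ∈ N (sqfree (A b))) : IsSquarefree (kerPart A φ) where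
  finite a := by
    let f : kerPart A φ a →ₗ[k] freePart k A a :=
      ((LinearMap.ker φ).subtype.restrictScalars k).restrict fun _ h => h
    refine Module.Finite.of_injective f ?_
    rintro ⟨⟨x, hx⟩, hx'⟩ ⟨⟨y, hy⟩, hy'⟩ h
    have : x = y := congrArg Subtype.val h
    subst this
    rfl
  X_smul_mem a j z hz := X_smul_mem_freePart hz j
  iSup_eq_top := by
    rw [eq_top_iff]
    rintro ⟨z, hz⟩ -
    obtain ⟨s, hs⟩ := exists_sum_freeProj (A := A) z
    have h0 := hN.map_freeProj_eq_zero hφ (z := z) hz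
    have : (⟨z, hz⟩ : LinearMap.ker φ) =
        ∑ a ∈ s, ⟨freeProj k A a z, h0 a⟩ := by
      apply Subtype.ext
      rw [AddSubmonoidClass.coe_finsetSum]
      exact hs
    rw [this]
    exact Submodule.sum_mem _ fun a _ => Submodule.mem_iSup_of_mem a (freeProj_mem a z)
  eq_zero_of_sum_eq_zero s f hf h a ha := by
    apply Subtype.ext
    have := freeProj_sum (k := k) (A := A) (z := fun a => (f a).1) hf ha
    rw [← AddSubmonoidClass.coe_finsetSum, h] at this
    simpa using this.symm
  eq_zero_of_X_smul_eq_zero a j _ z _ h := by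
    apply Subtype.ext
    refine X_smul_injective j ?_
    rw [← Submodule.coe_smul, h]
    simp
  exists_X_smul_eq a j ha z hz := by
    obtain ⟨y, hy, hyz, -⟩ := KoszulModule.exists_X_smul_eq ha hz
    -- `x_j φ(y) = φ(z) = 0`, and `x_j` is injective on `N a` because `a_j > 0`; so the quotient by
    -- `x_j` stays in the kernel.
    have : φ y = 0 := by
      refine hN.eq_zero_of_X_smul_eq_zero a j ha _ (map_mem_of_X_smul_mem hN.X_smul_mem φ hφ hy) ?_
      rw [← map_smul, hyz]
      exact z.2
    exact ⟨⟨y, this⟩, hy, Subtype.ext hyz⟩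

/-- A squarefree module has a minimal free cover generated in squarefree multidegrees. -/
lemma IsSquarefree.exists_minimal_cover (hN : IsSquarefree N) :
    ∃ (r : ℕ) (A : Fin r → Finset (Fin n))
      (φ : (Fin r → MvPolynomial (Fin n) k) →ₗ[MvPolynomial (Fin n) k] M),
      (∀ b, φ (Pi.single b 1) ∈ N (sqfree (A b))) ∧ Function.Surjective φ ∧
      (∀ z ∈ LinearMap.ker φ, ∀ b, constantCoeff (z b) = 0) ∧ ∀ b, N (sqfree (A b)) ≠ ⊥ := by
  classical
  obtain ⟨r, A, g, hg, hspan, hind⟩ := hN.exists_generators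
  let φ := Fintype.linearCombination (MvPolynomial (Fin n) k) g
  have hφ1 : ∀ b, φ (Pi.single b 1) = g b := fun b => by
    simp [φ, Fintype.linearCombination_apply_single]
  have hφ : ∀ b, φ (Pi.single b 1) ∈ N (sqfree (A b)) := fun b => by rw [hφ1]; exact hg b
  refine ⟨r, A, φ, hφ, ?_, ?_, ?_⟩
  -- Nakayama by induction on total degree: a non-squarefree multidegree is reached by some `x_j`
  -- from below, and a squarefree one is spanned by generators and decomposable elements.
  · have key : ∀ d a, a.degree = d → N a ≤ (LinearMap.range φ).restrictScalars k := by
      intro d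
      induction d using Nat.strong_induction_on with
      | _ d ih =>
      rintro a rfl
      rcases exists_eq_sqfree_or a with ⟨B, rfl⟩ | ⟨b, j, hbj, rfl⟩
      · refine (hspan B).trans (sup_le (Submodule.span_le.2 ?_) (Submodule.span_le.2 ?_))
        · rintro _ ⟨j, hj, m, hm, rfl⟩
          refine (LinearMap.range φ).smul_mem _ (ih _ ?_ _ rfl hm)
          rw [degree_sqfree, degree_sqfree]
          exact Finset.card_erase_lt_of_mem hj
        · rintro _ ⟨b, rfl⟩
          exact ⟨_, hφ1 b⟩
      · intro m hm
        obtain ⟨m', hm', rfl⟩ := hN.exists_X_smul_eq b j hbj m hm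
        refine (LinearMap.range φ).smul_mem _ (ih _ ?_ _ rfl hm')
        simp
    have h : (LinearMap.range φ).restrictScalars k = ⊤ := by
      rw [eq_top_iff, ← hN.iSup_eq_top]
      exact iSup_le fun a => key _ a rfl
    intro m
    have : m ∈ (LinearMap.range φ).restrictScalars k := h ▸ Submodule.mem_top
    exact this
  · intro z hz b
    -- In a relation of multidegree `sqfree B`, generators of exactly that multidegree have scalar
    -- coefficients and the other terms are decomposable, so independence modulo decomposables kills
    -- the scalars.
    have hmem : ∀ B, ∀ y ∈ freePart k A (sqfree B), φ y = 0 → ∀ b, A b = B →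
        constantCoeff (y b) = 0 := by
      intro B y hy h b hb
      have h1 := hind B (fun b => if A b = B then constantCoeff (y b) else 0)
        (fun b hb => if_neg hb) ?_
      · have := congrFun h1 b
        simpa [hb] using this
      have h2 : φ y - ∑ b, (if A b = B then 0 else y b) • g b =
          ∑ b, (if A b = B then constantCoeff (y b) else 0) • g b := by
        rw [Fintype.linearCombination_apply, ← Finset.sum_sub_distrib]
        refine Finset.sum_congr rfl fun b _ => ?_
        split_ifs with hb
        · rw [eq_C_of_mem_freePart_sqfree (z := y) (b := b) (hb ▸ hy)]
          rw [zero_smul, sub_zero, ← algebraMap_eq, algebraMap_smul, algebraMap_eq,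
            constantCoeff_C]
        · simp
      rw [← h2, h, zero_sub]
      refine Submodule.neg_mem _ (Submodule.sum_mem _ fun b _ => ?_)
      split_ifs with hb
      · simp
      rw [(y b).as_sum, Finset.sum_smul]
      refine Submodule.sum_mem _ fun m hm => ?_
      have hm' := hy b m hm
      -- Here `A b` is a proper subset of `B`; a vertex `j` of `B` outside `A b` must come from the
      -- coefficient monomial, so `x_j` can be factored out.
      obtain ⟨j, hj, hjb⟩ := Finset.exists_of_ssubset
        ((subset_of_add_sqfree_eq hm').ssubset_of_ne hb)
      have hmj : m j = 1 := by
        have := DFunLike.congr_fun hm' j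
        simpa [sqfree_apply, hj, hjb] using this
      have hm2 : m = (m - Finsupp.single j 1) + Finsupp.single j 1 :=
        (tsub_add_cancel_of_le (by rw [Finsupp.single_le_iff, hmj])).symm
      refine Submodule.subset_span ⟨j, hj,
        (monomial (m - Finsupp.single j 1) (coeff m (y b)) : MvPolynomial (Fin n) k) • g b, ?_, ?_⟩
      · have := monomial_smul_mem_of_X_smul_mem hN.X_smul_mem (m - Finsupp.single j 1) (coeff m (y b)) (hg b)
        convert this using 2
        apply add_right_cancel (b := Finsupp.single j 1)
        rw [sqfree_erase_add hj, add_right_comm, ← hm2, hm']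
      · rw [smul_smul, X, monomial_mul, one_mul, add_comm, ← hm2]
    -- The constant term of `z b` survives in the component of multidegree `sqfree (A b)`.
    have h1 := hmem _ _ (freeProj_mem (sqfree (A b)) z) (hN.map_freeProj_eq_zero hφ hz _) b rfl
    rwa [constantCoeff_eq, coeff_freeProj, if_pos (zero_add _)] at h1
  · intro b h
    -- If the piece were zero, then `g b = 0`, and the unit vector at `b` would be a forbidden
    -- relation.
    have := hind (A b) (Pi.single b 1) (fun c hc => Pi.single_eq_of_ne (fun h => hc (congrArg A h)) _)
    have h0 : g b = 0 := by simpa [h] using hg b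
    have h1 := congrFun (this (by simp [Pi.single_apply, h0])) b
    simp at h1

end Cover

/-! ### Resolutions of squarefree modules -/

section Resolution

variable {k : Type u} [Field k] {n : ℕ}

/-- The total grading of a submodule of a free module with basis in degrees `deg b`. -/
def totalGrading {r : ℕ} (deg : Fin r → ℤ)
    (K : Submodule (MvPolynomial (Fin n) k) (Fin r → MvPolynomial (Fin n) k)) (j : ℤ) :
    AddSubgroup K where
  carrier := {z | ∀ b, ∀ m ∈ (z.1 b).support, (m.degree : ℤ) + deg b = j}
  zero_mem' := by simp
  add_mem' := by
    classical
    intro y z hy hz b m hm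
    rcases Finset.mem_union.1 (support_add hm) with h | h
    exacts [hy b m h, hz b m h]
  neg_mem' := by
    intro z hz b m hm
    exact hz b m (by simpa using hm)

namespace MinimalGradedFreeResolution

variable {M : Type v} [AddCommGroup M] [Module (MvPolynomial (Fin n) k) M]

/-- The resolution of the zero module with all terms zero. -/
def zero [Subsingleton M] (𝓜 : ℤ → AddSubgroup M) :
    MinimalGradedFreeResolution (k := k) (n := n) 𝓜 where
  rank _ := 0
  deg _ b := b.elim0
  d _ := 0
  ε := 0
  ε_homogeneous b := b.elim0
  d_homogeneous _ b := b.elim0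
  ε_surjective _ := ⟨0, Subsingleton.elim _ _⟩
  exact_zero _ := ⟨fun _ => ⟨0, Subsingleton.elim _ _⟩, fun _ => Subsingleton.elim _ _⟩
  exact_succ _ _ := ⟨fun _ => ⟨0, Subsingleton.elim _ _⟩, fun _ => Subsingleton.elim _ _⟩
  minimal _ b := b.elim0

/-- A minimal free cover followed by a minimal resolution of its kernel. -/
def cons {𝓜 : ℤ → AddSubgroup M} {r : ℕ} (deg : Fin r → ℤ)
    (φ : (Fin r → MvPolynomial (Fin n) k) →ₗ[MvPolynomial (Fin n) k] M)
    (hφ : ∀ b, φ (Pi.single b 1) ∈ 𝓜 (deg b)) (hsurj : Function.Surjective φ)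
    (hmin : ∀ z ∈ LinearMap.ker φ, ∀ b, constantCoeff (z b) = 0)
    (F : MinimalGradedFreeResolution (k := k) (n := n) (totalGrading deg (LinearMap.ker φ))) :
    MinimalGradedFreeResolution (k := k) (n := n) 𝓜 where
  rank
    | 0 => r
    | h + 1 => F.rank h
  deg
    | 0 => deg
    | h + 1 => F.deg h
  d
    | 0 => (LinearMap.ker φ).subtype ∘ₗ F.ε
    | h + 1 => F.d h
  ε := φ
  ε_homogeneous := hφ
  d_homogeneous
    | 0 => fun b c m hm => F.ε_homogeneous b c m hm
    | h + 1 => F.d_homogeneous h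
  ε_surjective := hsurj
  exact_zero z := by
    refine ⟨fun hz => ?_, ?_⟩
    · obtain ⟨y, hy⟩ := F.ε_surjective ⟨z, hz⟩
      exact ⟨y, congrArg Subtype.val hy⟩
    · rintro ⟨y, rfl⟩
      exact (F.ε y).2
  exact_succ
    | 0 => fun z => by
      rw [← F.exact_zero z]
      exact Submodule.coe_eq_zero
    | h + 1 => F.exact_succ h
  minimal
    | 0 => fun b c => hmin _ (F.ε (Pi.single b 1)).2 c
    | h + 1 => F.minimal h

end MinimalGradedFreeResolution

/-- If `M` is the quotient of a finite free module by a submodule of projective dimension `< N`,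
then `M` has projective dimension `< N + 1`. -/
lemma hasProjectiveDimensionLT_succ_of_cover {R : Type u} [CommRing R] {M : Type u}
    [AddCommGroup M] [Module R M] {r : ℕ} (φ : (Fin r → R) →ₗ[R] M)
    (hφ : Function.Surjective φ) (N : ℕ)
    (hK : HasProjectiveDimensionLT (ModuleCat.of R (LinearMap.ker φ)) N) :
    HasProjectiveDimensionLT (ModuleCat.of R M) (N + 1) := by
  let S : ShortComplex (ModuleCat.{u} R) :=
    { X₁ := ModuleCat.of R (LinearMap.ker φ)
      X₂ := ModuleCat.of R (Fin r → R)
      X₃ := ModuleCat.of R M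
      f := ModuleCat.ofHom (LinearMap.ker φ).subtype
      g := ModuleCat.ofHom φ
      zero := by ext x; exact x.2 }
  have hS : S.ShortExact :=
    { exact := by
        rw [ShortComplex.ShortExact.moduleCat_exact_iff_function_exact]
        exact LinearMap.exact_subtype_ker_map φ
      mono_f := (ModuleCat.mono_iff_injective _).2 (Submodule.injective_subtype _)
      epi_g := (ModuleCat.epi_iff_surjective _).2 hφ }
  have : Projective S.X₂ := ModuleCat.projective_of_free (Pi.basisFun R (Fin r))
  exact hS.hasProjectiveDimensionLT_X₃ N hK inferInstance

/-- A squarefree module which vanishes in squarefree multidegrees of support smaller than `d` has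
a minimal resolution with basis in degrees at most `n`, and projective dimension at most `n - d`. -/
theorem IsSquarefree.exists_resolution (p : ℕ) {M : Type u} [AddCommGroup M]
    [Module (MvPolynomial (Fin n) k) M] [Module k M] [IsScalarTower k (MvPolynomial (Fin n) k) M]
    {N : (Fin n →₀ ℕ) → Submodule k M} (hN : IsSquarefree N) {𝓜 : ℤ → AddSubgroup M}
    (h𝓜 : ∀ B, ∀ m ∈ N (sqfree B), m ∈ 𝓜 B.card) (d : ℕ)
    (hd : ∀ B : Finset (Fin n), B.card < d → N (sqfree B) = ⊥) (hp : n + 1 ≤ d + p) :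
    (∃ F : MinimalGradedFreeResolution (k := k) (n := n) 𝓜, ∀ h b, F.deg h b ≤ n) ∧
      HasProjectiveDimensionLT (ModuleCat.of (MvPolynomial (Fin n) k) M) p := by
  induction p generalizing M d with
  | zero =>
    -- With `p = 0` one has `d > n`, so every squarefree piece vanishes, there are no generators,
    -- and `M = 0`.
    obtain ⟨r, A, φ, -, hsurj, -, hA⟩ := hN.exists_minimal_cover
    have : IsEmpty (Fin r) := ⟨fun b => hA b (hd _ (by
      have := Finset.card_le_univ (A b)
      rw [Fintype.card_fin] at this
      omega))⟩
    have hM : Subsingleton M := hsurj.subsingleton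
    refine ⟨⟨.zero 𝓜, fun h b => b.elim0⟩, ?_⟩
    rw [hasProjectiveDimensionLT_zero_iff_isZero]
    exact ModuleCat.isZero_of_subsingleton _
  | succ p ih =>
    obtain ⟨r, A, φ, hφ, hsurj, hmin, hA⟩ := hN.exists_minimal_cover
    have hcard : ∀ b, d ≤ (A b).card := fun b => by
      by_contra h
      exact hA b (hd _ (not_le.1 h))
    have hgrad : ∀ B, ∀ z ∈ kerPart A φ (sqfree B),
        z ∈ totalGrading (fun b => ((A b).card : ℤ)) (LinearMap.ker φ) B.card := by
      intro B z hz b m hm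
      have := congrArg Finsupp.degree (hz b m hm)
      rw [map_add, degree_sqfree, degree_sqfree] at this
      change (m.degree : ℤ) + (A b).card = B.card
      exact_mod_cast this
    -- A nonzero entry `z b` gives `A b ⊆ B` with `d ≤ #(A b)` and `#B ≤ d`, hence `A b = B`; the
    -- entry is then a constant, which minimality forces to be zero.
    have hker : ∀ B : Finset (Fin n), B.card < d + 1 → kerPart A φ (sqfree B) = ⊥ := by
      intro B hB
      rw [eq_bot_iff]
      intro z hz
      apply Subtype.ext
      ext1 b
      by_contra h0
      have hb : A b = B := Finset.eq_of_subset_of_card_le (subset_of_mem_freePart hz h0)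
        (by have := hcard b; omega)
      refine h0 ?_
      rw [eq_C_of_mem_freePart_sqfree (z := z.1) (b := b) (hb ▸ hz), hmin _ z.2 b, C_0]
      rfl
    obtain ⟨⟨F, hF⟩, hpd⟩ := ih (hN.ker hφ)
      hgrad (d + 1) hker (by omega)
    refine ⟨⟨.cons _ φ (fun b => h𝓜 _ _ (hφ b)) hsurj hmin F, ?_⟩,
      hasProjectiveDimensionLT_succ_of_cover φ hsurj p hpd⟩
    rintro (_ | h) b
    · have := Finset.card_le_univ (A b)
      rw [Fintype.card_fin] at this
      exact Int.ofNat_le.2 this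
    · exact hF h b

end Resolution

/-! ### The Koszul modules as squarefree modules -/

section KoszulHomology

variable {k : Type u} [Field k] {n : ℕ}

/-- With `A = id`, `v_σ` has multidegree `sqfree σ`, and so does each term `x_j v_{σ ∖ {j}}`. -/
lemma boundaryBasis_mem (σ : Finset (Fin n)) : boundaryBasis k n σ ∈ freePart k id (sqfree σ) := by
  classical
  refine Submodule.sum_mem _ fun j hj => ?_
  rw [mem_freePart]
  intro τ m hm
  rcases eq_or_ne τ (σ.erase j) with rfl | h
  · rw [Pi.single_eq_same, mul_comm] at hm
    have : m = Finsupp.single j 1 := by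
      by_contra hne
      apply hm
      rw [← C_1, ← C_neg, ← C_pow, mul_comm, coeff_C_mul, coeff_X, if_neg (Ne.symm hne),
        mul_zero]
    rw [this, id, add_comm, sqfree_erase_add hj]
  · simp [h] at hm

lemma boundary_mem {a : Fin n →₀ ℕ} {z : Koszul k n} (hz : z ∈ freePart k id a) :
    boundary k n z ∈ freePart k id a := by
  classical
  refine map_mem_of_X_smul_mem (N := freePart k id) (A := id)
    (fun a j m hm => X_smul_mem_freePart hm j) (boundary k n) (fun σ => ?_) hz
  rw [boundary_single, one_smul]
  exact boundaryBasis_mem σ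

lemma freeProj_mem_chains (Δ : PreAbstractSimplicialComplex (Fin n)) {i : ℕ} {z : Koszul k n}
    (hz : z ∈ chains k Δ i) (a : Fin n →₀ ℕ) : freeProj k id a z ∈ chains k Δ i :=
  fun σ hσ => hz σ (freeProj_ne_zero hσ)

lemma boundary_freeProj (a : Fin n →₀ ℕ) (z : Koszul k n) :
    boundary k n (freeProj k id a z) = freeProj k id a (boundary k n z) := by
  classical
  obtain ⟨s, hs⟩ := exists_sum_freeProj (A := id) z
  conv_rhs => rw [hs, map_sum, map_sum]
  rw [Finset.sum_congr rfl fun b _ => freeProj_of_mem (boundary_mem (freeProj_mem b z)) a,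
    Finset.sum_ite_eq']
  split_ifs with h
  · rfl
  · rw [hs, map_sum, Finset.sum_eq_zero, map_zero]
    intro b hb
    rw [freeProj_of_mem (freeProj_mem b z), if_neg (by rintro rfl; exact h hb)]

lemma boundaryBasis_apply_erase {A : Finset (Fin n)} {j : Fin n} (hj : j ∈ A) :
    boundaryBasis k n A (A.erase j) =
      (-1 : MvPolynomial (Fin n) k) ^ (A.filter (· < j)).card * X j := by
  rw [boundaryBasis, Finset.sum_apply, Finset.sum_eq_single j]
  · rw [Pi.single_eq_same]
  · intro l hl hlj
    refine Pi.single_eq_of_ne (fun h => hlj ?_) _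
    by_contra
    have : l ∈ A.erase j := Finset.mem_erase.2 ⟨hlj, hl⟩
    rw [h] at this
    simp at this
  · exact fun h => absurd hj h

variable (k) in
/-- The multigrading of the Koszul modules. -/
def koszulPart (Δ : PreAbstractSimplicialComplex (Fin n)) (i : ℕ) (a : Fin n →₀ ℕ) :
    Submodule k (W k Δ i) :=
  ((freePart k id a).comap ((cycles k Δ i).subtype.restrictScalars k)).map
    (((boundaries k Δ i).submoduleOf (cycles k Δ i)).mkQ.restrictScalars k)

lemma mem_koszulPart {Δ : PreAbstractSimplicialComplex (Fin n)} {i : ℕ} {a : Fin n →₀ ℕ}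
    {w : W k Δ i} : w ∈ koszulPart k Δ i a ↔ ∃ z : cycles k Δ i, z.1 ∈ freePart k id a ∧
      ((boundaries k Δ i).submoduleOf (cycles k Δ i)).mkQ z = w := Iff.rfl

lemma mkQ_eq_zero {Δ : PreAbstractSimplicialComplex (Fin n)} {i : ℕ} {z : cycles k Δ i} :
    ((boundaries k Δ i).submoduleOf (cycles k Δ i)).mkQ z = 0 ↔
      ∃ y ∈ chains k Δ (i + 1), boundary k n y = z.1 := by
  rw [Submodule.mkQ_apply, Submodule.Quotient.mk_eq_zero]
  rfl

/-- Chains, cycles and boundaries are compatible with the projections to multidegrees, which gives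
the decomposition. Bijectivity of `x_j` is inherited from chains: both a cycle and a chain bounding
`x_j z` can be divided by `x_j` within the chains of `Δ`. -/
theorem isSquarefree_koszulPart (Δ : PreAbstractSimplicialComplex (Fin n)) (i : ℕ) :
    IsSquarefree (koszulPart k Δ i) where
  finite a := by
    have : Module.Finite k
        ((freePart k id a).comap ((cycles k Δ i).subtype.restrictScalars k)) := by
      let f : (freePart k id a).comap ((cycles k Δ i).subtype.restrictScalars k) →ₗ[k]
          freePart k (id : Finset (Fin n) → _) a :=
        ((cycles k Δ i).subtype.restrictScalars k).restrict fun _ h => h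
      refine Module.Finite.of_injective f ?_
      rintro ⟨⟨x, hx⟩, hx'⟩ ⟨⟨y, hy⟩, hy'⟩ h
      have : x = y := congrArg Subtype.val h
      subst this
      rfl
    exact Module.Finite.map _ _
  X_smul_mem a j w hw := by
    obtain ⟨z, hz, rfl⟩ := mem_koszulPart.1 hw
    exact mem_koszulPart.2 ⟨(X j : MvPolynomial (Fin n) k) • z, X_smul_mem_freePart hz j,
      map_smul _ _ _⟩
  iSup_eq_top := by
    rw [eq_top_iff]
    intro w _
    obtain ⟨⟨z, hz⟩, rfl⟩ := Submodule.mkQ_surjective _ w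
    obtain ⟨s, hs⟩ := exists_sum_freeProj (A := id) z
    have h0 : ∀ a, freeProj k id a z ∈ cycles k Δ i := fun a =>
      ⟨freeProj_mem_chains Δ hz.1 a, LinearMap.mem_ker.2 <| by
        rw [boundary_freeProj, LinearMap.mem_ker.1 hz.2, map_zero]⟩
    have : (⟨z, hz⟩ : cycles k Δ i) = ∑ a ∈ s, ⟨freeProj k id a z, h0 a⟩ := by
      apply Subtype.ext
      rw [AddSubmonoidClass.coe_finsetSum]
      exact hs
    rw [this, map_sum]
    exact Submodule.sum_mem _ fun a _ => Submodule.mem_iSup_of_mem a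
      (mem_koszulPart.2 ⟨_, freeProj_mem a z, rfl⟩)
  eq_zero_of_sum_eq_zero s f hf h a ha := by
    choose! z hz hzf using fun a ha => mem_koszulPart.1 (hf a ha)
    rw [Finset.sum_congr rfl fun a ha => (hzf a ha).symm, ← map_sum, mkQ_eq_zero] at h
    obtain ⟨y, hy, hyz⟩ := h
    rw [← hzf a ha, mkQ_eq_zero]
    refine ⟨freeProj k id a y, freeProj_mem_chains Δ hy a, ?_⟩
    rw [boundary_freeProj, hyz, AddSubmonoidClass.coe_finsetSum]
    exact freeProj_sum (z := fun a => (z a).1) hz ha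
  eq_zero_of_X_smul_eq_zero a j ha w hw h := by
    obtain ⟨z, hz, rfl⟩ := mem_koszulPart.1 hw
    rw [← map_smul, mkQ_eq_zero] at h
    obtain ⟨y, hy, hyz⟩ := h
    -- Only the component of `y` in the multidegree of `x_j z` matters; its quotient `x` by `x_j`
    -- satisfies `x_j ∂x = x_j z`.
    obtain ⟨x, hx, hxy, hx0⟩ := exists_X_smul_eq ha
      (freeProj_mem (k := k) (A := id) (a + Finsupp.single j 1) y)
    rw [mkQ_eq_zero]
    refine ⟨x, fun σ hσ => hy σ (freeProj_ne_zero (hx0 σ hσ)), X_smul_injective j ?_⟩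
    rw [← map_smul, hxy, boundary_freeProj, hyz]
    exact (freeProj_of_mem (X_smul_mem_freePart hz j) _).trans (if_pos rfl)
  exists_X_smul_eq a j ha w hw := by
    obtain ⟨z, hz, rfl⟩ := mem_koszulPart.1 hw
    obtain ⟨x, hx, hxz, hx0⟩ := exists_X_smul_eq ha hz
    have hxc : x ∈ cycles k Δ i := by
      refine ⟨fun σ hσ => z.2.1 σ (hx0 σ hσ), X_smul_injective j ?_⟩
      rw [← map_smul, hxz, smul_zero]
      exact z.2.2
    refine ⟨_, mem_koszulPart.2 ⟨⟨x, hxc⟩, hx, rfl⟩, ?_⟩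
    rw [← map_smul]
    exact congrArg _ (Subtype.ext hxz)

lemma koszulPart_sqfree_eq_bot (Δ : PreAbstractSimplicialComplex (Fin n)) {i : ℕ} (hi : 0 < i)
    {B : Finset (Fin n)} (hB : B.card < i + 1) : koszulPart k Δ i (sqfree B) = ⊥ := by
  rw [eq_bot_iff]
  intro w hw
  obtain ⟨⟨z, hzc⟩, hz, rfl⟩ := mem_koszulPart.1 hw
  change z ∈ freePart k id (sqfree B) at hz
  -- A face in the support has `i` elements and lies in `B`, which has at most `i`.
  have hsupp : ∀ σ, z σ ≠ 0 → σ = B := fun σ hσ =>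
    Finset.eq_of_subset_of_card_le (subset_of_mem_freePart (A := id) hz hσ)
      (by rw [(hzc.1 σ hσ).1]; omega)
  have hzs : z = Pi.single B (z B) := by
    ext1 σ
    rcases eq_or_ne σ B with rfl | h
    · simp
    · rw [Pi.single_eq_of_ne h]
      by_contra h0
      exact h (hsupp σ h0)
  have hz0 : z = 0 := by
    by_contra hne
    have hzB : z B ≠ 0 := fun h => hne (by rw [hzs, h, Pi.single_zero])
    -- This needs `i > 0`. The coefficient of `∂z` at `B ∖ {j}` is `± x_j` times that of `z` at `B`,
    -- nonzero in a domain.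
    obtain ⟨j, hj⟩ : B.Nonempty := Finset.card_pos.1 (by rw [(hzc.1 B hzB).1]; exact hi)
    have h := LinearMap.mem_ker.1 hzc.2
    rw [hzs, boundary_single] at h
    have h1 := congrFun h (B.erase j)
    rw [Pi.smul_apply, boundaryBasis_apply_erase hj, Pi.zero_apply, smul_eq_mul] at h1
    exact mul_ne_zero hzB (mul_ne_zero (pow_ne_zero _ (by simp)) (X_ne_zero j)) h1
  subst hz0
  exact map_zero _

lemma mem_gradedPiece_of_mem_koszulPart (Δ : PreAbstractSimplicialComplex (Fin n)) (i : ℕ)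
    (B : Finset (Fin n)) (w : W k Δ i) (hw : w ∈ koszulPart k Δ i (sqfree B)) :
    w ∈ gradedPiece k Δ i B.card := by
  obtain ⟨z, hz, rfl⟩ := mem_koszulPart.1 hw
  refine ⟨z, fun σ m hm => ?_, rfl⟩
  have := congrArg Finsupp.degree (hz σ m hm)
  rw [map_add, degree_sqfree, degree_sqfree] at this
  exact_mod_cast this

end KoszulHomology

end KoszulModule
end

/-- Moving `i + 1` to the left avoids truncated subtraction: for `i ≥ n` the inequality forces
projective dimension `⊥`, that is, `W_i(Δ) = 0`. -/
theorem proposition6p1 {k : Type*} [Field k] [CharZero k] (n : ℕ)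
    (Δ : PreAbstractSimplicialComplex (Fin n)) (i : ℕ) (hi : 0 < i) :
    KoszulModule.regularity (k := k) (n := n) (KoszulModule.gradedPiece k Δ i) ≤
        (((n : ℤ) : WithTop ℤ) : WithBot (WithTop ℤ)) ∧
      CategoryTheory.projectiveDimension
          (ModuleCat.of (MvPolynomial (Fin n) k) (KoszulModule.W k Δ i)) + ((i + 1 : ℕ) : WithBot ℕ∞) ≤
        (n : WithBot ℕ∞) := by
  obtain ⟨⟨F, hF⟩, hpd⟩ := (KoszulModule.isSquarefree_koszulPart (k := k) Δ i).exists_resolution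
    (n - i) (KoszulModule.mem_gradedPiece_of_mem_koszulPart Δ i) (i + 1)
    (fun B => KoszulModule.koszulPart_sqfree_eq_bot Δ hi) (by omega)
  constructor
  -- The regularity is an infimum over minimal resolutions, so one suffices; `deg ≤ n` gives `deg -
  -- h ≤ n`.
  · refine iInf_le_of_le F (iSup_le fun h => iSup_le fun b => ?_)
    have := hF h b
    exact WithBot.coe_le_coe.2 (WithTop.coe_le_coe.2 (by omega))
  -- Projective dimension `< n - i` means the module is zero when `n ≤ i`, and otherwise projective
  -- dimension at most `q = n - i - 1`.
  · rcases Nat.eq_zero_or_pos (n - i) with h0 | h0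
    · rw [h0, CategoryTheory.hasProjectiveDimensionLT_zero_iff_isZero,
        ← CategoryTheory.projectiveDimension_eq_bot_iff] at hpd
      rw [hpd, WithBot.bot_add]
      exact bot_le
    · obtain ⟨q, hq⟩ : ∃ q, n - i = q + 1 := ⟨n - i - 1, by omega⟩
      rw [hq] at hpd
      have := (CategoryTheory.projectiveDimension_le_iff _ q).2 hpd
      refine (add_le_add_left this _).trans ?_
      rw [← Nat.cast_add]
      exact Nat.cast_le.2 (by omega)
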